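/- Conventions. An exact category is an additive category with a Quillen exact structure, i.e. a class of kernel–cokernel pairs $A\to B\to C$ (conflations), closed under isomorphism, such that admissible monomorphisms (first maps of conflations) and admissible epimorphisms (second maps of conflations) contain all identities and are closed under composition, and such that pushouts of admissible monomorphisms (resp. pullbacks of admissible epimorphisms) along arbitrary maps exist and are again admissible monomorphisms (resp. epimorphisms). It is weakly idempotent complete if every split monomorphism has a cokernel and every split epimorphism has a kernel. A functor between exact categories is exact if it is additive and maps conflations to conflations. A model structure consists of classes of cofibrations, fibrations and weak equivalences such that weak equivalences have the two-out-of-three property, all three classes are closed under retracts, trivial cofibrations (resp. cofibrations) have the left lifting property with respect to fibrations (resp. trivial fibrations), and every map factors as a trivial cofibration followed by a fibration and as a cofibration followed by a trivial fibration; neither limits and colimits nor functoriality of the factorizations are required. An object $X$ is cofibrant (resp. trivial) if $0\to X$ is a cofibration (resp. a weak equivalence), and fibrant if $X\to 0$ is a fibration. An exact model category is an exact category with a model structure in which the (trivial) cofibrations are precisely the admissible monomorphisms whose cokernel is cofibrant (resp. cofibrant and trivial), and the (trivial) fibrations are precisely the admissible epimorphisms whose kernel is fibrant (resp. fibrant and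 trivial); its associated Hovey triple $(\mathcal C,\mathcal W,\mathcal F)$ consists of the classes of cofibrant, trivial and fibrant objects. An adjunction $(F,G)$ with unit $\eta$ and counit $\varepsilon$ is a Quillen adjunction if the left adjoint $F$ preserves cofibrations and trivial cofibrations. A Quillen adjunction is a Quillen equivalence if for every cofibrant $X$ and fibrant $Y$ a map $FX\to Y$ is a weak equivalence if and only if its adjunct $X\to GY$ is a weak equivalence. Proposition 3.6 (Dalezios). Let $\mathcal M$ and $\mathcal M'$ be weakly idempotent complete exact model categories with associated Hovey triples $(\mathcal C,\mathcal W,\mathcal F)$ and $(\mathcal C',\mathcal W',\mathcal F')$. Let $(F,G)$ be a Quillen adjunction $\mathcal M\rightleftarrows\mathcal M'$ (with $F\colon\mathcal M\to\mathcal M'$ the left adjoint) such that $F$ and $G$ are exact, $F(\mathcal W)\subseteq\mathcal W'$ and $G(\mathcal W')\subseteq\mathcal W$. Then $(F,G)$ is a Quillen equivalence if and only if the unit $\eta_X\colon X\to GFX$ is a weak equivalence for every $X\in\mathcal C$ and the counit $\varepsilon_Y\colon FGY\to Y$ is a weak equivalence for every $Y\in\mathcal F'$. -/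

import Mathlib

open CategoryTheory Limits HomotopicalAlgebra

universe v₁ u₁ v₂ u₂

/-- A (Quillen) exact structure on an additive category: a class of kernel-cokernel pairs
`A ⟶ B ⟶ C`, called conflations, closed under isomorphisms, such that the admissible
monomorphisms (the first maps of conflations) and the admissible epimorphisms (the second maps of
conflations) contain identities, are closed under composition, and are stable under pushouts along
arbitrary maps, respectively pullbacks along arbitrary maps (which are required to exist). -/
class ExactStructure (C : Type u₁) [Category.{v₁} C] [Preadditive C] [HasFiniteBiproducts C] where
  /-- the class of conflations (short exact sequences) -/
  conflation : ObjectProperty (ShortComplex C)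
  of_iso : ∀ {S T : ShortComplex C}, (S ≅ T) → conflation S → conflation T
  isKernel : ∀ {S : ShortComplex C}, conflation S →
    Nonempty (IsLimit (KernelFork.ofι S.f S.zero))
  isCokernel : ∀ {S : ShortComplex C}, conflation S →
    Nonempty (IsColimit (CokernelCofork.ofπ S.g S.zero))
  id_mono : ∀ X : C, ∃ (Z : C) (p : X ⟶ Z) (w : 𝟙 X ≫ p = 0), conflation (.mk (𝟙 X) p w)
  id_epi : ∀ X : C, ∃ (K : C) (i : K ⟶ X) (w : i ≫ 𝟙 X = 0), conflation (.mk i (𝟙 X) w)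
  comp_mono : ∀ {X Y Z : C} (f : X ⟶ Y) (g : Y ⟶ Z),
    (∃ (A : C) (p : Y ⟶ A) (w : f ≫ p = 0), conflation (.mk f p w)) →
    (∃ (A : C) (p : Z ⟶ A) (w : g ≫ p = 0), conflation (.mk g p w)) →
    ∃ (A : C) (p : Z ⟶ A) (w : (f ≫ g) ≫ p = 0), conflation (.mk (f ≫ g) p w)
  comp_epi : ∀ {X Y Z : C} (f : X ⟶ Y) (g : Y ⟶ Z),
    (∃ (K : C) (i : K ⟶ X) (w : i ≫ f = 0), conflation (.mk i f w)) →
    (∃ (K : C) (i : K ⟶ Y) (w : i ≫ g = 0), conflation (.mk i g w)) →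
    ∃ (K : C) (i : K ⟶ X) (w : i ≫ f ≫ g = 0), conflation (.mk i (f ≫ g) w)
  pushout_mono : ∀ {X Y X' : C} (f : X ⟶ Y) (g : X ⟶ X'),
    (∃ (A : C) (p : Y ⟶ A) (w : f ≫ p = 0), conflation (.mk f p w)) →
    ∃ (Y' : C) (g' : Y ⟶ Y') (f' : X' ⟶ Y'), IsPushout f g g' f' ∧
      ∃ (A : C) (p : Y' ⟶ A) (w : f' ≫ p = 0), conflation (.mk f' p w)
  pullback_epi : ∀ {X Y Y' : C} (f : X ⟶ Y) (g : Y' ⟶ Y),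
    (∃ (K : C) (i : K ⟶ X) (w : i ≫ f = 0), conflation (.mk i f w)) →
    ∃ (X' : C) (g' : X' ⟶ X) (f' : X' ⟶ Y'), IsPullback g' f' f g ∧
      ∃ (K : C) (i : K ⟶ X') (w : i ≫ f' = 0), conflation (.mk i f' w)

/-- Conflations (short exact sequences) of an exact category. -/
abbrev IsConflation {C : Type u₁} [Category.{v₁} C] [Preadditive C] [HasFiniteBiproducts C]
    [ExactStructure C] (S : ShortComplex C) : Prop :=
  ExactStructure.conflation S

/-- Weak idempotent completeness: split monomorphisms have cokernels and split epimorphisms have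
kernels. -/
class WeaklyIdempotentComplete (C : Type u₁) [Category.{v₁} C] [Preadditive C] : Prop where
  hasCokernel : ∀ {X Y : C} (f : X ⟶ Y) [IsSplitMono f], HasCokernel f
  hasKernel : ∀ {X Y : C} (f : X ⟶ Y) [IsSplitEpi f], HasKernel f

/-- A (closed) model structure on a category: cofibrations, fibrations and weak equivalences
subject to two-out-of-three, closure under retracts, lifting and factorization. No limits or
colimits are required to exist in the underlying category. -/
class ModelStructure (C : Type u₁) [Category.{v₁} C] extends
    CategoryWithCofibrations C, CategoryWithFibrations C, CategoryWithWeakEquivalences C where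
  two_out_of_three : (HomotopicalAlgebra.weakEquivalences C).HasTwoOutOfThreeProperty
  retract_weakEquivalences : (HomotopicalAlgebra.weakEquivalences C).IsStableUnderRetracts
  retract_fibrations : (HomotopicalAlgebra.fibrations C).IsStableUnderRetracts
  retract_cofibrations : (HomotopicalAlgebra.cofibrations C).IsStableUnderRetracts
  lift_trivialCofibration : ∀ {A B X Y : C} (i : A ⟶ B) (p : X ⟶ Y),
    Cofibration i → WeakEquivalence i → Fibration p → HasLiftingProperty i p
  lift_trivialFibration : ∀ {A B X Y : C} (i : A ⟶ B) (p : X ⟶ Y),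
    Cofibration i → Fibration p → WeakEquivalence p → HasLiftingProperty i p
  factor_trivialCofibration_fibration :
    MorphismProperty.HasFactorization (trivialCofibrations C) (HomotopicalAlgebra.fibrations C)
  factor_cofibration_trivialFibration :
    MorphismProperty.HasFactorization (HomotopicalAlgebra.cofibrations C) (trivialFibrations C)

/-- An object is trivial if it is weakly equivalent to zero, i.e. `0 ⟶ X` is a weak equivalence
(the initial object is the zero object in the additive categories considered here). -/
abbrev IsTrivialObject {C : Type u₁} [Category.{v₁} C] [HasInitial C]
    [CategoryWithWeakEquivalences C] (X : C) : Prop :=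
  WeakEquivalence (initial.to X)

/-- An exact model structure on an exact category: a model structure whose (trivial) cofibrations
are the admissible monomorphisms with (trivially) cofibrant cokernel, and whose (trivial) fibrations
are the admissible epimorphisms with (trivially) fibrant kernel. Its associated Hovey triple
consists of the cofibrant (`IsCofibrant`), the trivial (`IsTrivialObject`) and the fibrant
(`IsFibrant`) objects. -/
class ExactModelStructure (C : Type u₁) [Category.{v₁} C] [Preadditive C] [HasFiniteBiproducts C]
    [ExactStructure C] extends ModelStructure C where
  cofibration_iff : ∀ {X Y : C} (f : X ⟶ Y), Cofibration f ↔
    ∃ (Z : C) (p : Y ⟶ Z) (w : f ≫ p = 0), IsConflation (.mk f p w) ∧ IsCofibrant Z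
  trivialCofibration_iff : ∀ {X Y : C} (f : X ⟶ Y), Cofibration f ∧ WeakEquivalence f ↔
    ∃ (Z : C) (p : Y ⟶ Z) (w : f ≫ p = 0), IsConflation (.mk f p w) ∧
      IsCofibrant Z ∧ IsTrivialObject Z
  fibration_iff : ∀ {X Y : C} (f : X ⟶ Y), Fibration f ↔
    ∃ (K : C) (i : K ⟶ X) (w : i ≫ f = 0), IsConflation (.mk i f w) ∧ IsFibrant K
  trivialFibration_iff : ∀ {X Y : C} (f : X ⟶ Y), Fibration f ∧ WeakEquivalence f ↔
    ∃ (K : C) (i : K ⟶ X) (w : i ≫ f = 0), IsConflation (.mk i f w) ∧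
      IsFibrant K ∧ IsTrivialObject K

/-- An exact functor between exact categories: an additive functor which maps conflations to
conflations. -/
structure IsExactFunctor {C : Type u₁} [Category.{v₁} C] [Preadditive C] [HasFiniteBiproducts C]
    [ExactStructure C] {D : Type u₂} [Category.{v₂} D] [Preadditive D] [HasFiniteBiproducts D]
    [ExactStructure D] (F : C ⥤ D) : Prop extends F.Additive where
  map_conflation : ∀ S : ShortComplex C, IsConflation S → IsConflation (S.map F)

/-- An adjunction is a Quillen adjunction if its left adjoint preserves cofibrations and trivial
cofibrations. -/
structure IsQuillenAdjunction {C : Type u₁} [Category.{v₁} C] [ModelStructure C]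
    {D : Type u₂} [Category.{v₂} D] [ModelStructure D] {F : C ⥤ D} {G : D ⥤ C}
    (_adj : F ⊣ G) : Prop where
  map_cofibration : ∀ {X Y : C} (f : X ⟶ Y), Cofibration f → Cofibration (F.map f)
  map_trivialCofibration : ∀ {X Y : C} (f : X ⟶ Y), Cofibration f → WeakEquivalence f →
    Cofibration (F.map f) ∧ WeakEquivalence (F.map f)

/-- A Quillen equivalence: a Quillen adjunction such that, for all cofibrant `X` and fibrant `Y`,
a map `F X ⟶ Y` is a weak equivalence if and only if its adjunct `X ⟶ G Y` is one. -/
structure IsQuillenEquivalence {C : Type u₁} [Category.{v₁} C] [HasInitial C] [ModelStructure C]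
    {D : Type u₂} [Category.{v₂} D] [HasTerminal D] [ModelStructure D] {F : C ⥤ D} {G : D ⥤ C}
    (adj : F ⊣ G) : Prop extends IsQuillenAdjunction adj where
  weakEquivalence_iff : ∀ (X : C) (Y : D), IsCofibrant X → IsFibrant Y → ∀ f : F.obj X ⟶ Y,
    WeakEquivalence f ↔ WeakEquivalence (adj.homEquiv X Y f)

/-! An exact functor that preserves trivial objects preserves all weak equivalences
(`IsExactFunctor.map_weakEquivalence`). Indeed a weak equivalence is a trivial cofibration followed
by a trivial fibration, so its image is an admissible mono with trivial cokernel followed by an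
admissible epi with trivial kernel. Such maps are weak equivalences even when the cokernel is not
cofibrant or the kernel not fibrant; this rests on two Noether-type conflations comparing a map with
its factorization. Once `F` and `G` preserve weak equivalences, two-out-of-three translates between
adjuncts and the unit and counit. -/

/-! ### Noether-type conflations in exact categories -/

section ExactCategory

variable {C : Type u₁} [Category.{v₁} C] [Preadditive C] [HasFiniteBiproducts C]
  [ExactStructure C]

/-- If `f` is an admissible monomorphism, then `f` and any cokernel of `f` form a conflation. -/
lemma IsConflation.of_isColimit {X Y Z Z' : C} {f : X ⟶ Y} {p : Y ⟶ Z} {w : f ≫ p = 0}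
    (h : IsConflation (.mk f p w)) {p' : Y ⟶ Z'} (w' : f ≫ p' = 0)
    (hp' : IsColimit (CokernelCofork.ofπ p' w')) : IsConflation (.mk f p' w') := by
  obtain ⟨hp⟩ := ExactStructure.isCokernel h
  refine ExactStructure.of_iso (S := .mk f p w) (T := .mk f p' w')
    (ShortComplex.isoMk (Iso.refl _) (Iso.refl _) (hp.coconePointUniqueUpToIso hp') ?_ ?_) h
  · simp
  · simpa using (hp.comp_coconePointUniqueUpToIso_hom hp' WalkingParallelPair.one).symm

/-- If `p` is an admissible epimorphism, then any kernel of `p` and `p` form a conflation. -/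
lemma IsConflation.of_isLimit {K K' X Y : C} {i : K ⟶ X} {p : X ⟶ Y} {w : i ≫ p = 0}
    (h : IsConflation (.mk i p w)) {i' : K' ⟶ X} (w' : i' ≫ p = 0)
    (hi' : IsLimit (KernelFork.ofι i' w')) : IsConflation (.mk i' p w') := by
  obtain ⟨hi⟩ := ExactStructure.isKernel h
  refine ExactStructure.of_iso (S := .mk i p w) (T := .mk i' p w')
    (ShortComplex.isoMk (hi.conePointUniqueUpToIso hi') (Iso.refl _) (Iso.refl _) ?_ ?_) h
  · simpa using hi.conePointUniqueUpToIso_hom_comp hi' WalkingParallelPair.zero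
  · simp

/-- Admissible monomorphisms are stable under arbitrary pushout squares. -/
lemma IsConflation.of_isPushout {X Y Z X' Y' : C} {f : X ⟶ Y} {p : Y ⟶ Z} {w : f ≫ p = 0}
    (h : IsConflation (.mk f p w)) {g : X ⟶ X'} {g' : Y ⟶ Y'} {f' : X' ⟶ Y'}
    (sq : IsPushout f g g' f') :
    ∃ (A : C) (p' : Y' ⟶ A) (w' : f' ≫ p' = 0), IsConflation (.mk f' p' w') := by
  obtain ⟨Y₁, g₁, f₁, sq₁, A, q, wq, hq⟩ := ExactStructure.pushout_mono f g ⟨_, _, _, h⟩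
  let e := sq₁.isoIsPushout _ _ sq
  have he : f₁ ≫ e.hom = f' := sq₁.inr_isoIsPushout_hom _ _ sq
  refine ⟨A, e.inv ≫ q, by rw [← he]; simp [wq], ExactStructure.of_iso
    (S := .mk f₁ q wq) (ShortComplex.isoMk (Iso.refl _) e (Iso.refl _) ?_ ?_) hq⟩
  · simp [he]
  · simp

/-- Admissible epimorphisms are stable under arbitrary pullback squares. -/
lemma IsConflation.of_isPullback {K X Y X' Y' : C} {i : K ⟶ X} {f : X ⟶ Y} {w : i ≫ f = 0}
    (h : IsConflation (.mk i f w)) {g : Y' ⟶ Y} {g' : X' ⟶ X} {f' : X' ⟶ Y'}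
    (sq : IsPullback g' f' f g) :
    ∃ (A : C) (j : A ⟶ X') (w' : j ≫ f' = 0), IsConflation (.mk j f' w') := by
  obtain ⟨X₁, g₁, f₁, sq₁, A, j, wj, hj⟩ := ExactStructure.pullback_epi f g ⟨_, _, _, h⟩
  let e := sq₁.isoIsPullback _ _ sq
  have he : e.hom ≫ f' = f₁ := sq₁.isoIsPullback_hom_snd _ _ sq
  refine ⟨A, j ≫ e.hom, by simp [he, wj], ExactStructure.of_iso
    (S := .mk j f₁ wj) (ShortComplex.isoMk (Iso.refl _) e (Iso.refl _) ?_ ?_) hj⟩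
  · simp
  · simp [he]

/-- If `i` and `i ≫ p` are admissible monomorphisms and `p` is an admissible epimorphism, then the
kernel of `p` and the cokernels of `i` and `i ≫ p` form a conflation. -/
lemma exists_isConflation_cokernels {K A E B D Z : C} {k : K ⟶ E} {p : E ⟶ B} {i : A ⟶ E}
    {q : E ⟶ D} {r : B ⟶ Z} {wk : k ≫ p = 0} {wi : i ≫ q = 0} {wr : (i ≫ p) ≫ r = 0}
    (hp : IsConflation (.mk k p wk)) (hi : IsConflation (.mk i q wi))
    (hr : IsConflation (.mk (i ≫ p) r wr)) :
    ∃ (g : D ⟶ Z) (w : (k ≫ q) ≫ g = 0), IsConflation (.mk (k ≫ q) g w) := by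
  have := hasBinaryBiproducts_of_finite_biproducts C
  obtain ⟨kerP⟩ := ExactStructure.isKernel hp
  obtain ⟨cokP⟩ := ExactStructure.isCokernel hp
  obtain ⟨cokI⟩ := ExactStructure.isCokernel hi
  obtain ⟨kerR⟩ := ExactStructure.isKernel hr
  obtain ⟨cokR⟩ := ExactStructure.isCokernel hr
  have monoK : Mono k := mono_of_isLimit_fork kerP
  have monoIP : Mono (i ≫ p) := mono_of_isLimit_fork kerR
  have epiP : Epi p := epi_of_isColimit_cofork cokP
  have epiQ : Epi q := epi_of_isColimit_cofork cokI
  -- The composite `p ≫ r` is an admissible epi; its kernel is identified below with `K ⊞ A`.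
  obtain ⟨L, l, wl, hl⟩ := ExactStructure.comp_epi p r ⟨_, _, _, hp⟩ ⟨_, _, _, hr⟩
  have wd : biprod.desc k i ≫ p ≫ r = 0 := by
    ext
    · simp [reassoc_of% wk]
    · simpa using wr
  have monoD : Mono (biprod.desc k i) := by
    refine Preadditive.mono_of_cancel_zero _ fun t ht => ?_
    have e : t = biprod.lift (t ≫ biprod.fst) (t ≫ biprod.snd) := by ext <;> simp
    rw [e, biprod.lift_desc] at ht
    have h₂ : t ≫ biprod.snd = 0 := by
      rw [← cancel_mono (i ≫ p), zero_comp]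
      simpa [wk] using congr($ht ≫ p)
    have h₁ : t ≫ biprod.fst = 0 := by
      rw [h₂, zero_comp, add_zero] at ht
      rw [← cancel_mono k, ht, zero_comp]
    ext <;> simp [h₁, h₂]
  have hd : IsConflation (.mk (biprod.desc k i) (p ≫ r) wd) := by
    refine IsConflation.of_isLimit hl wd (KernelFork.IsLimit.ofι' _ _ fun t ht => ?_)
    obtain ⟨a, ha⟩ := KernelFork.IsLimit.lift' kerR (t ≫ p) (by simpa using ht)
    replace ha : a ≫ i ≫ p = t ≫ p := ha
    obtain ⟨b, hb⟩ := KernelFork.IsLimit.lift' kerP (t - a ≫ i) (by simp [ha])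
    replace hb : b ≫ k = t - a ≫ i := hb
    exact ⟨biprod.lift b a, by simp [biprod.lift_desc, hb]⟩
  -- Projecting `K ⊞ A` to `K` collapses `A`, so the pushout of `E` is the cokernel `D` of `i`; this
  -- makes `k ≫ q` an admissible mono.
  have sq : IsPushout (biprod.desc k i) biprod.fst q (k ≫ q) := by
    refine ⟨⟨by ext <;> simp [wi]⟩, ⟨PushoutCocone.IsColimit.mk _
      (fun s => (CokernelCofork.IsColimit.desc' cokI s.inl ?_).1) ?_ ?_ ?_⟩⟩
    · simpa using biprod.inr ≫= s.condition
    · intro s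
      exact (CokernelCofork.IsColimit.desc' cokI s.inl _).2
    · intro s
      have h : q ≫ _ = _ := (CokernelCofork.IsColimit.desc' cokI s.inl
        (by simpa using biprod.inr ≫= s.condition)).2
      rw [Category.assoc, h]
      simpa using biprod.inl ≫= s.condition
    · intro s m hm _
      have h : q ≫ _ = _ := (CokernelCofork.IsColimit.desc' cokI s.inl
        (by simpa using biprod.inr ≫= s.condition)).2
      rw [← cancel_epi q, hm, h]
  obtain ⟨_, _, _, hT⟩ := hd.of_isPushout sq
  obtain ⟨g, hg⟩ := CokernelCofork.IsColimit.desc' cokI (p ≫ r) (by simpa using wr)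
  replace hg : q ≫ g = p ≫ r := hg
  have wg : (k ≫ q) ≫ g = 0 := by simp [hg, reassoc_of% wk]
  have epiR : Epi r := epi_of_isColimit_cofork cokR
  have epiG : Epi g := by
    have : Epi (q ≫ g) := hg ▸ epi_comp _ _
    exact epi_of_epi q g
  refine ⟨g, wg, hT.of_isColimit wg (CokernelCofork.IsColimit.ofπ' _ _ fun t ht => ?_)⟩
  obtain ⟨b, hb⟩ := CokernelCofork.IsColimit.desc' cokP (q ≫ t) (by simpa using ht)
  replace hb : p ≫ b = q ≫ t := hb
  obtain ⟨c, hc⟩ := CokernelCofork.IsColimit.desc' cokR b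
    (by simp [hb, reassoc_of% wi])
  replace hc : r ≫ c = b := hc
  exact ⟨c, by rw [← cancel_epi q, reassoc_of% hg, hc, hb]⟩

/-- If `p` and `i ≫ p` are admissible epimorphisms and `i` is an admissible monomorphism, then the
kernels of `i ≫ p` and `p` and the cokernel of `i` form a conflation. -/
lemma exists_isConflation_kernels {K L A E B Z : C} {k : K ⟶ A} {l : L ⟶ E} {i : A ⟶ E}
    {p : E ⟶ B} {q : E ⟶ Z} {wk : k ≫ i ≫ p = 0} {wl : l ≫ p = 0} {wi : i ≫ q = 0}
    (hk : IsConflation (.mk k (i ≫ p) wk)) (hp : IsConflation (.mk l p wl))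
    (hi : IsConflation (.mk i q wi)) :
    ∃ (g : K ⟶ L) (w : g ≫ l ≫ q = 0), IsConflation (.mk g (l ≫ q) w) := by
  have := hasBinaryBiproducts_of_finite_biproducts C
  obtain ⟨kerK⟩ := ExactStructure.isKernel hk
  obtain ⟨cokK⟩ := ExactStructure.isCokernel hk
  obtain ⟨kerP⟩ := ExactStructure.isKernel hp
  obtain ⟨kerI⟩ := ExactStructure.isKernel hi
  obtain ⟨cokI⟩ := ExactStructure.isCokernel hi
  have monoK : Mono k := mono_of_isLimit_fork kerK
  have monoL : Mono l := mono_of_isLimit_fork kerP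
  have monoI : Mono i := mono_of_isLimit_fork kerI
  have epiIP : Epi (i ≫ p) := epi_of_isColimit_cofork cokK
  have epiQ : Epi q := epi_of_isColimit_cofork cokI
  -- Dually, `k ≫ i` is an admissible mono, whose cokernel turns out to be `B ⊞ Z`.
  obtain ⟨T, t, wt, ht⟩ := ExactStructure.comp_mono k i ⟨_, _, _, hk⟩ ⟨_, _, _, hi⟩
  have wd : (k ≫ i) ≫ biprod.lift p q = 0 := by
    ext
    · simpa using wk
    · simp [wi]
  have epiD : Epi (biprod.lift p q) := by
    refine Preadditive.epi_of_cancel_zero _ fun s hs => ?_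
    have e : s = biprod.desc (biprod.inl ≫ s) (biprod.inr ≫ s) := by ext <;> simp
    rw [e, biprod.lift_desc] at hs
    have h₁ : biprod.inl ≫ s = 0 := by
      rw [← cancel_epi (i ≫ p), comp_zero]
      simpa [reassoc_of% wi] using congr(i ≫ $hs)
    have h₂ : biprod.inr ≫ s = 0 := by
      rw [h₁, comp_zero, zero_add] at hs
      rw [← cancel_epi q, hs, comp_zero]
    ext <;> simp [h₁, h₂]
  have hd : IsConflation (.mk (k ≫ i) (biprod.lift p q) wd) := by
    refine IsConflation.of_isColimit ht wd (CokernelCofork.IsColimit.ofπ' _ _ fun s hs => ?_)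
    obtain ⟨a, ha⟩ := CokernelCofork.IsColimit.desc' cokK (i ≫ s) (by simpa using hs)
    replace ha : (i ≫ p) ≫ a = i ≫ s := ha
    obtain ⟨b, hb⟩ := CokernelCofork.IsColimit.desc' cokI (s - p ≫ a)
      (by simp [← ha])
    replace hb : q ≫ b = s - p ≫ a := hb
    exact ⟨biprod.desc a b, by simp [biprod.lift_desc, hb]⟩
  -- Pulling back along `Z ⟶ B ⊞ Z` imposes `p = 0`, leaving the kernel `L` of `p`; hence `l ≫ q` is
  -- an admissible epi.
  have sq : IsPullback l (l ≫ q) (biprod.lift p q) biprod.inr := by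
    refine ⟨⟨by ext <;> simp [wl]⟩, ⟨PullbackCone.IsLimit.mk _
      (fun s => (KernelFork.IsLimit.lift' kerP s.fst ?_).1) ?_ ?_ ?_⟩⟩
    · simpa using s.condition =≫ biprod.fst
    · intro s
      exact (KernelFork.IsLimit.lift' kerP s.fst _).2
    · intro s
      have h : _ ≫ l = _ := (KernelFork.IsLimit.lift' kerP s.fst
        (by simpa using s.condition =≫ biprod.fst)).2
      rw [reassoc_of% h]
      simpa using s.condition =≫ biprod.snd
    · intro s m hm _
      have h : _ ≫ l = _ := (KernelFork.IsLimit.lift' kerP s.fst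
        (by simpa using s.condition =≫ biprod.fst)).2
      rw [← cancel_mono l, hm, h]
  obtain ⟨_, _, _, hT⟩ := hd.of_isPullback sq
  obtain ⟨g, hg⟩ := KernelFork.IsLimit.lift' kerP (k ≫ i) (by simpa using wk)
  replace hg : g ≫ l = k ≫ i := hg
  have wg : g ≫ l ≫ q = 0 := by simp [reassoc_of% hg, wi]
  have monoG : Mono g := by
    have : Mono (g ≫ l) := hg ▸ mono_comp _ _
    exact mono_of_mono g l
  refine ⟨g, wg, hT.of_isLimit wg (KernelFork.IsLimit.ofι' _ _ fun s hs => ?_)⟩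
  obtain ⟨b, hb⟩ := KernelFork.IsLimit.lift' kerI (s ≫ l) (by simpa using hs)
  replace hb : b ≫ i = s ≫ l := hb
  obtain ⟨c, hc⟩ := KernelFork.IsLimit.lift' kerK b (by simp [reassoc_of% hb, wl])
  replace hc : c ≫ k = b := hc
  exact ⟨c, by rw [← cancel_mono l, Category.assoc, hg, reassoc_of% hc, hb]⟩

end ExactCategory

/-! ### Two-out-of-three and factorizations -/

section ModelStructure

variable {C : Type u₁} [Category.{v₁} C] [ModelStructure C]

lemma ModelStructure.weakEquivalence_comp {X Y Z : C} {f : X ⟶ Y} {g : Y ⟶ Z}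
    (hf : WeakEquivalence f) (hg : WeakEquivalence g) : WeakEquivalence (f ≫ g) := by
  have := ModelStructure.two_out_of_three (C := C)
  rw [weakEquivalence_iff] at *
  exact MorphismProperty.comp_mem _ _ _ hf hg

lemma ModelStructure.weakEquivalence_of_precomp {X Y Z : C} {f : X ⟶ Y} {g : Y ⟶ Z}
    (hf : WeakEquivalence f) (hfg : WeakEquivalence (f ≫ g)) : WeakEquivalence g := by
  have := ModelStructure.two_out_of_three (C := C)
  rw [weakEquivalence_iff] at *
  exact MorphismProperty.of_precomp _ _ _ hf hfg

lemma ModelStructure.weakEquivalence_of_postcomp {X Y Z : C} {f : X ⟶ Y} {g : Y ⟶ Z}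
    (hg : WeakEquivalence g) (hfg : WeakEquivalence (f ≫ g)) : WeakEquivalence f := by
  have := ModelStructure.two_out_of_three (C := C)
  rw [weakEquivalence_iff] at *
  exact MorphismProperty.of_postcomp _ _ _ hg hfg

lemma ModelStructure.exists_trivialCofibration_fibration {X Y : C} (f : X ⟶ Y) :
    ∃ (E : C) (i : X ⟶ E) (p : E ⟶ Y),
      i ≫ p = f ∧ Cofibration i ∧ WeakEquivalence i ∧ Fibration p := by
  have := ModelStructure.factor_trivialCofibration_fibration (C := C)
  let h := MorphismProperty.factorizationData (trivialCofibrations C) (fibrations C) f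
  exact ⟨h.Z, h.i, h.p, h.fac, ⟨h.hi.1⟩, ⟨h.hi.2⟩, ⟨h.hp⟩⟩

lemma ModelStructure.exists_cofibration_trivialFibration {X Y : C} (f : X ⟶ Y) :
    ∃ (E : C) (i : X ⟶ E) (p : E ⟶ Y),
      i ≫ p = f ∧ Cofibration i ∧ Fibration p ∧ WeakEquivalence p := by
  have := ModelStructure.factor_cofibration_trivialFibration (C := C)
  let h := MorphismProperty.factorizationData (cofibrations C) (trivialFibrations C) f
  exact ⟨h.Z, h.i, h.p, h.fac, ⟨h.hi⟩, ⟨h.hp.1⟩, ⟨h.hp.2⟩⟩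

end ModelStructure

/-! ### Weak equivalences from trivial kernels and cokernels -/

section ExactModelStructure

variable {C : Type u₁} [Category.{v₁} C] [Preadditive C] [HasFiniteBiproducts C]
  [ExactStructure C] [ExactModelStructure C]

open ModelStructure

/-- An admissible monomorphism with trivial cokernel is a weak equivalence. -/
lemma IsConflation.weakEquivalence_f {X Y Z : C} {f : X ⟶ Y} {r : Y ⟶ Z} {w : f ≫ r = 0}
    (h : IsConflation (.mk f r w)) (hZ : IsTrivialObject Z) : WeakEquivalence f := by
  obtain ⟨E, i, p, rfl, hi, hp, hp'⟩ := exists_cofibration_trivialFibration f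
  obtain ⟨D, q, wq, hq, hD⟩ := (ExactModelStructure.cofibration_iff i).1 hi
  obtain ⟨K, k, wk, hk, hK, hK'⟩ := (ExactModelStructure.trivialFibration_iff p).1 ⟨hp, hp'⟩
  -- The conflation `K ⟶ D ⟶ Z` exhibits `g` as a trivial fibration, so triviality passes from `Z`
  -- to `D` and `i` is a trivial cofibration.
  obtain ⟨g, wg, hg⟩ := exists_isConflation_cokernels hk hq h
  have hg' : WeakEquivalence g :=
    ((ExactModelStructure.trivialFibration_iff g).2 ⟨K, _, _, hg, hK, hK'⟩).2
  have hD' : IsTrivialObject D :=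
    weakEquivalence_of_postcomp hg' (by rwa [Subsingleton.elim (initial.to D ≫ g) (initial.to Z)])
  exact weakEquivalence_comp
    ((ExactModelStructure.trivialCofibration_iff i).2 ⟨D, q, wq, hq, hD, hD'⟩).2 hp'

/-- An admissible epimorphism with trivial kernel is a weak equivalence. -/
lemma IsConflation.weakEquivalence_g {K X Y : C} {k : K ⟶ X} {f : X ⟶ Y} {w : k ≫ f = 0}
    (h : IsConflation (.mk k f w)) (hK : IsTrivialObject K) : WeakEquivalence f := by
  obtain ⟨E, i, p, rfl, hi, hi', hp⟩ := exists_trivialCofibration_fibration f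
  obtain ⟨Z, q, wq, hq, hZ, hZ'⟩ := (ExactModelStructure.trivialCofibration_iff i).1 ⟨hi, hi'⟩
  obtain ⟨L, l, wl, hl, hL⟩ := (ExactModelStructure.fibration_iff p).1 hp
  -- In `K ⟶ L ⟶ Z` the map `g` is a trivial cofibration, so `L` is trivial because `K` is.
  obtain ⟨g, wg, hg⟩ := exists_isConflation_kernels h hl hq
  have hg' : WeakEquivalence g :=
    ((ExactModelStructure.trivialCofibration_iff g).2 ⟨Z, _, _, hg, hZ, hZ'⟩).2
  have hL' : IsTrivialObject L := by
    have := weakEquivalence_comp hK hg'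
    rwa [Subsingleton.elim (initial.to K ≫ g) (initial.to L)] at this
  exact weakEquivalence_comp hi'
    ((ExactModelStructure.trivialFibration_iff p).2 ⟨L, l, wl, hl, hL, hL'⟩).2

variable {D : Type u₂} [Category.{v₂} D] [Preadditive D] [HasFiniteBiproducts D]
  [ExactStructure D] [ExactModelStructure D]

/-- An exact functor which preserves trivial objects preserves weak equivalences. -/
lemma IsExactFunctor.map_weakEquivalence {F : C ⥤ D} (hF : IsExactFunctor F)
    (hFW : ∀ X : C, IsTrivialObject X → IsTrivialObject (F.obj X)) {X Y : C} {f : X ⟶ Y}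
    (hf : WeakEquivalence f) : WeakEquivalence (F.map f) := by
  have := hF.toAdditive
  obtain ⟨E, i, p, rfl, hi, hp, hp'⟩ := exists_cofibration_trivialFibration f
  obtain ⟨Z, q, wq, hq, -, hZ⟩ := (ExactModelStructure.trivialCofibration_iff i).1
    ⟨hi, weakEquivalence_of_postcomp hp' hf⟩
  obtain ⟨K, k, wk, hk, -, hK⟩ := (ExactModelStructure.trivialFibration_iff p).1 ⟨hp, hp'⟩
  rw [F.map_comp]
  exact weakEquivalence_comp
    (IsConflation.weakEquivalence_f (hF.map_conflation _ hq) (hFW _ hZ))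
    (IsConflation.weakEquivalence_g (hF.map_conflation _ hk) (hFW _ hK))

end ExactModelStructure

/-! ### The unit and counit criterion -/

theorem proposition3p6
    {M : Type u₁} [Category.{v₁} M] [Preadditive M] [HasFiniteBiproducts M]
    [ExactStructure M] [WeaklyIdempotentComplete M] [ExactModelStructure M]
    {M' : Type u₂} [Category.{v₂} M'] [Preadditive M'] [HasFiniteBiproducts M']
    [ExactStructure M'] [WeaklyIdempotentComplete M'] [ExactModelStructure M']
    {F : M ⥤ M'} {G : M' ⥤ M} (adj : F ⊣ G) (hadj : IsQuillenAdjunction adj)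
    (hF : IsExactFunctor F) (hG : IsExactFunctor G)
    (hFW : ∀ X : M, IsTrivialObject X → IsTrivialObject (F.obj X))
    (hGW : ∀ Y : M', IsTrivialObject Y → IsTrivialObject (G.obj Y)) :
    IsQuillenEquivalence adj ↔
      (∀ X : M, IsCofibrant X → WeakEquivalence (adj.unit.app X)) ∧
      (∀ Y : M', IsFibrant Y → WeakEquivalence (adj.counit.app Y)) := by
  constructor
  · intro h
    refine ⟨fun X hX => ?_, fun Y hY => ?_⟩
    -- For a fibrant replacement `j : F.obj X ⟶ R`, the adjunct of `j` is the unit followed by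
    -- `G.map j`, so `G.map j` can be cancelled.
    · obtain ⟨R, j, p, -, -, hj, hp⟩ :=
        ModelStructure.exists_trivialCofibration_fibration (terminal.from (F.obj X))
      have hR : IsFibrant R := by
        rwa [isFibrant_iff, Subsingleton.elim (terminal.from R) p]
      have := (h.weakEquivalence_iff X R hX hR j).1 hj
      rw [adj.homEquiv_unit] at this
      exact ModelStructure.weakEquivalence_of_postcomp (hG.map_weakEquivalence hGW hj) this
    -- Dually, a cofibrant replacement `p : Q ⟶ G.obj Y` has as adjunct `F.map p` followed by the
    -- counit.
    · obtain ⟨Q, i, p, -, hi, -, hp⟩ :=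
        ModelStructure.exists_cofibration_trivialFibration (initial.to (G.obj Y))
      have hQ : IsCofibrant Q := by
        rwa [isCofibrant_iff, Subsingleton.elim (initial.to Q) i]
      have := (h.weakEquivalence_iff Q Y hQ hY ((adj.homEquiv Q Y).symm p)).2 (by simpa using hp)
      rw [adj.homEquiv_counit] at this
      exact ModelStructure.weakEquivalence_of_precomp (hF.map_weakEquivalence hFW hp) this
  · rintro ⟨hη, hε⟩
    refine ⟨hadj, fun X Y hX hY f => ⟨fun hf => ?_, fun hf => ?_⟩⟩
    · rw [adj.homEquiv_unit]
      exact ModelStructure.weakEquivalence_comp (hη X hX) (hG.map_weakEquivalence hGW hf)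
    · rw [← (adj.homEquiv X Y).symm_apply_apply f, adj.homEquiv_counit]
      exact ModelStructure.weakEquivalence_comp (hF.map_weakEquivalence hFW hf) (hε Y hY)
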